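/- An *ordered semigroup* is a commutative monoid $(S,+,0)$ with a translation-invariant partial order for which $0$ is the smallest element. For elements $s,t$ of a partially ordered set, write $s\ll t$ if for every increasing sequence $(t_n)_n$ that has a supremum and satisfies $t\le\sup_n t_n$ there is an $n_0$ with $s\le t_{n_0}$. Consider the following axioms on $S$: - **O1.** Every increasing sequence in $S$ has a supremum. - **O2.** For every $s\in S$ there is a sequence $(s_n)$ with $s_n\ll s_{n+1}$ for all $n$ and $s=\sup_n s_n$. - **O3.** If $s_i\ll t_i$ for $i=1,2$, then $s_1+s_2\ll t_1+t_2$. - **O4.** If $(s_n)$ and $(t_n)$ are increasing sequences, then $\sup_n(s_n+t_n)=\sup_n s_n+\sup_n t_n$. - **O5.** If $s'\ll s\le t$, then there exists $r\in S$ such that $s'+r\le t\le s+r$. A *functional* on $S$ is a map $\lambda\colon S\to[0,\infty]$ that preserves $0$, addition, the order, and suprema of increasing sequences; let $\mathrm F(S)$ be the set of functionals on $S$. For $s\in S$ let $\hat s\colon \mathrm F(S)\to[0,\infty]$, $\hat s(\lambda)=\lambda(s)$. Let $S_{\mathbb R}$ be the set of functions $f\colon \mathrm F(S)\to[0,\infty]$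 for which there exist $s_i\in S$ and positive integers $n_i$ ($i=1,2,\dots$) such that the sequence $(\hat s_i/n_i)_i$ is pointwise increasing and $f(\lambda)=\sup_i \hat s_i(\lambda)/n_i$ for all $\lambda\in\mathrm F(S)$. Endow $S_{\mathbb R}$ with pointwise addition and the pointwise order, and let $\ll$ on $S_{\mathbb R}$ be the relation defined above, taken in the ordered set $S_{\mathbb R}$. **Proposition.** Let $S$ be an ordered semigroup satisfying O1–O5, and let $f',f,g\in S_{\mathbb R}$ be such that $f'\ll f\le g$. Then there exist $h,h'\in S_{\mathbb R}$ such that $f'\ll h\ll f$ and $h+h'=g$. -/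

import Mathlib

open scoped ENNReal

/-- Sequential compact containment `s ≪ t` in an ordered set: whenever `(u n)` is an increasing
sequence with a supremum `c` such that `t ≤ c`, some `u n` already dominates `s`. -/
def SeqWayBelow {P : Type*} [PartialOrder P] (s t : P) : Prop :=
  ∀ (u : ℕ → P) (c : P), Monotone u → IsLUB (Set.range u) c → t ≤ c → ∃ n, s ≤ u n

/-- The axioms O1-O5 on a positive, abelian ordered semigroup (a commutative monoid with a
translation invariant order, whose smallest element is `0`). -/
structure IsCuAlmostAlgebraic (S : Type*) [AddCommMonoid S] [PartialOrder S]
    [IsOrderedAddMonoid S] : Prop where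
  /-- `0` is the smallest element. -/
  zero_le : ∀ s : S, 0 ≤ s
  /-- Every increasing sequence has a supremum. -/
  O1 : ∀ u : ℕ → S, Monotone u → ∃ c, IsLUB (Set.range u) c
  /-- Every element is the supremum of a rapidly increasing sequence. -/
  O2 : ∀ s : S, ∃ u : ℕ → S, (∀ n, SeqWayBelow (u n) (u (n + 1))) ∧ IsLUB (Set.range u) s
  /-- Compact containment is compatible with addition. -/
  O3 : ∀ s₁ s₂ t₁ t₂ : S, SeqWayBelow s₁ t₁ → SeqWayBelow s₂ t₂ →
    SeqWayBelow (s₁ + s₂) (t₁ + t₂)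
  /-- Suprema of increasing sequences are compatible with addition. -/
  O4 : ∀ (u v : ℕ → S) (a b : S), Monotone u → Monotone v →
    IsLUB (Set.range u) a → IsLUB (Set.range v) b →
    IsLUB (Set.range fun n => u n + v n) (a + b)
  /-- Almost algebraic order. -/
  O5 : ∀ s' s t : S, SeqWayBelow s' s → s ≤ t → ∃ r : S, s' + r ≤ t ∧ t ≤ s + r

/-- The cone `F(S)` of functionals on `S`: maps `S → [0,∞]` preserving zero, addition, order, and
the suprema of increasing sequences. -/
structure CuFunctional (S : Type*) [AddCommMonoid S] [PartialOrder S] where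
  /-- The underlying additive map. -/
  toAddMonoidHom : S →+ ℝ≥0∞
  mono : Monotone toAddMonoidHom
  map_isLUB : ∀ (u : ℕ → S) (c : S), Monotone u → IsLUB (Set.range u) c →
    IsLUB (Set.range fun n => toAddMonoidHom (u n)) (toAddMonoidHom c)

/-- The function `ŝ` on `F(S)`, `ŝ(l) = l(s)`. -/
def CuFunctional.hat {S : Type*} [AddCommMonoid S] [PartialOrder S] (s : S)
    (l : CuFunctional S) : ℝ≥0∞ :=
  l.toAddMonoidHom s

/-- The realification `S_ℝ`: all functions on `F(S)` that are pointwise suprema of increasing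
sequences `(ŝᵢ / nᵢ)` with `sᵢ ∈ S` and `nᵢ` a positive integer. (Such functions are automatically
linear, and lower semicontinuous for the usual topology of `F(S)`.) Addition and order are
pointwise. -/
def realification (S : Type*) [AddCommMonoid S] [PartialOrder S] :
    AddSubmonoid (CuFunctional S → ℝ≥0∞) where
  carrier := {f | ∃ (s : ℕ → S) (n : ℕ → ℕ), (∀ i, 0 < n i) ∧
    (Monotone fun (i : ℕ) (l : CuFunctional S) => CuFunctional.hat (s i) l / (n i : ℝ≥0∞)) ∧
    ∀ l : CuFunctional S, f l = ⨆ i, CuFunctional.hat (s i) l / (n i : ℝ≥0∞)}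
  zero_mem' := by
    refine ⟨fun _ => 0, fun _ => 1, fun _ => one_pos, monotone_const, fun l => ?_⟩
    simp [CuFunctional.hat]
  add_mem' := by
    rintro f g ⟨s, n, hn, hs, hf⟩ ⟨t, m, hm, ht, hg⟩
    have key : ∀ (i : ℕ) (l : CuFunctional S),
        CuFunctional.hat (m i • s i + n i • t i) l / ((n i * m i : ℕ) : ℝ≥0∞) =
          CuFunctional.hat (s i) l / (n i : ℝ≥0∞) + CuFunctional.hat (t i) l / (m i : ℝ≥0∞) := by
      intro i l
      have hn0 : (n i : ℝ≥0∞) ≠ 0 := by exact_mod_cast (hn i).ne'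
      have hm0 : (m i : ℝ≥0∞) ≠ 0 := by exact_mod_cast (hm i).ne'
      have hnt : (n i : ℝ≥0∞) ≠ ∞ := ENNReal.natCast_ne_top _
      have hmt : (m i : ℝ≥0∞) ≠ ∞ := ENNReal.natCast_ne_top _
      simp only [CuFunctional.hat, map_add, map_nsmul, nsmul_eq_mul, Nat.cast_mul]
      rw [ENNReal.add_div, ENNReal.mul_div_mul_left _ _ hn0 hnt,
        mul_comm (n i : ℝ≥0∞) (m i : ℝ≥0∞), ENNReal.mul_div_mul_left _ _ hm0 hmt]
    refine ⟨fun i => m i • s i + n i • t i, fun i => n i * m i,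
      fun i => Nat.mul_pos (hn i) (hm i), ?_, ?_⟩
    · intro i j hij l
      simp only [key]
      exact add_le_add (hs hij l) (ht hij l)
    · intro l
      simp only [key, Pi.add_apply, hf, hg]
      exact ENNReal.iSup_add_iSup_of_monotone (fun i j hij => hs hij l) (fun i j hij => ht hij l)

/-! If `g` were `t̂` and `f` were `ŝ` with `s ≤ t`, O5 would give `s' + r ≤ t ≤ s + r`, which is a
complement only up to the gap between `s'` and `s`. In the realification this gap can be averaged
away. Interpolation produces an increasing path `c_x` of elements with `c_x ≪ s`, defined at dyadic
`x ≥ 0`. The function `h` is a constant multiple of the integral of `ĉ_x` over `[0,1]`, a supremum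
of dyadic Riemann sums, and `h'` is the supremum of the corresponding means of approximate
complements. At level `N` the gaps are between nearby points of the path, so they telescope and
their mean is `O(2^{-N})` wherever `ŝ` is finite. Where `ŝ` is infinite, the complements are chosen
infinite. This is `iSup_dyadicMean_add`.

Two further ingredients are needed. The pointwise inequality `ŝ/n ≤ t̂/m` must be turned into an
inequality in `S`, to which O5 applies: a Hahn–Banach argument gives `p • x ≤ q • t` for `x ≪ s`, at
the price of a factor `B/A < 1` (`exists_nsmul_le`, `exists_complement`). And `≪` in the
realification must be reduced to `≪` in `S`: by compactness of `F(S)`, `x ≪ s` and `a < b` give `a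
x̂ ≪ b ŝ` (`pointwiseWayBelow_of_lt`), whence `exists_hat_between`, which leaves room for the factor
`B/A`. -/

/-! ### Elementary properties of `≪`. -/

namespace SeqWayBelow

variable {P : Type*} [PartialOrder P] {a b c : P}

theorem monotone {u : ℕ → P} (hu : ∀ n, SeqWayBelow (u n) (u (n + 1))) : Monotone u := by
  refine monotone_nat_of_le_succ fun n => ?_
  obtain ⟨_, hn⟩ := hu n (fun _ => u (n + 1)) _ monotone_const (by simp) le_rfl
  exact hn

theorem le (h : SeqWayBelow a b) : a ≤ b := by
  obtain ⟨_, hn⟩ := h (fun _ => b) b monotone_const (by simp) le_rfl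
  exact hn

theorem trans_le (h : SeqWayBelow a b) (hbc : b ≤ c) : SeqWayBelow a c :=
  fun u d hu hd hcd => h u d hu hd (hbc.trans hcd)

theorem of_le (hab : a ≤ b) (h : SeqWayBelow b c) : SeqWayBelow a c := by
  intro u d hu hd hcd
  obtain ⟨n, hn⟩ := h u d hu hd hcd
  exact ⟨n, hab.trans hn⟩

theorem of_isLUB {u : ℕ → P} (hu : ∀ n, SeqWayBelow (u n) (u (n + 1)))
    (hc : IsLUB (Set.range u) c) (n : ℕ) : SeqWayBelow (u n) c :=
  (hu n).trans_le (hc.1 ⟨n + 1, rfl⟩)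

end SeqWayBelow

/-! ### Interpolation, and regularization of additive maps to functionals. -/

namespace IsCuAlmostAlgebraic

variable {S : Type*} [AddCommMonoid S] [PartialOrder S] [IsOrderedAddMonoid S]

theorem exists_between (hS : IsCuAlmostAlgebraic S) {x z : S} (h : SeqWayBelow x z) :
    ∃ y, SeqWayBelow x y ∧ SeqWayBelow y z := by
  obtain ⟨u, hu, hz⟩ := hS.O2 z
  obtain ⟨n, hn⟩ := h u z (SeqWayBelow.monotone hu) hz le_rfl
  exact ⟨u (n + 1), (hu n).of_le hn, SeqWayBelow.of_isLUB hu hz _⟩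

theorem nsmul_wayBelow (hS : IsCuAlmostAlgebraic S) {x y : S} (h : SeqWayBelow x y) (n : ℕ) :
    SeqWayBelow (n • x) (n • y) := by
  induction n with
  | zero =>
    intro u c _ _ _
    exact ⟨0, by simpa using hS.zero_le _⟩
  | succ n ih =>
    rw [succ_nsmul, succ_nsmul]
    exact hS.O3 _ _ _ _ ih h

/-- The largest functional below an additive monotone map. -/
noncomputable def regularize (hS : IsCuAlmostAlgebraic S) (L : S →+ ℝ≥0∞) (hL : Monotone L) :
    CuFunctional S where
  toAddMonoidHom :=
    { toFun := fun s => ⨆ (x : S) (_ : SeqWayBelow x s), L x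
      map_zero' := by
        refine le_antisymm (iSup₂_le fun x hx => ?_) _root_.zero_le
        rw [le_antisymm hx.le (hS.zero_le x), map_zero]
      map_add' := by
        intro s t
        apply le_antisymm
        · refine iSup₂_le fun x hx => ?_
          obtain ⟨u, hu, hs⟩ := hS.O2 s
          obtain ⟨v, hv, ht⟩ := hS.O2 t
          have hum := SeqWayBelow.monotone hu
          have hvm := SeqWayBelow.monotone hv
          obtain ⟨n, hn⟩ := hx (fun n => u n + v n) (s + t) (hum.add hvm)
            (hS.O4 u v s t hum hvm hs ht) le_rfl
          refine (hL hn).trans ?_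
          rw [map_add]
          exact add_le_add
            (le_iSup₂_of_le (u n) (SeqWayBelow.of_isLUB hu hs n) le_rfl)
            (le_iSup₂_of_le (v n) (SeqWayBelow.of_isLUB hv ht n) le_rfl)
        · have h0 : ∀ r : S, SeqWayBelow 0 r := fun r u c _ _ _ => ⟨0, hS.zero_le _⟩
          refine ENNReal.biSup_add_biSup_le ⟨0, h0 s⟩ ⟨0, h0 t⟩ fun x hx y hy => ?_
          rw [← map_add]
          exact le_iSup₂_of_le (x + y) (hS.O3 _ _ _ _ hx hy) le_rfl }
  mono := fun s t hst => iSup₂_le fun x hx => le_iSup₂_of_le x (hx.trans_le hst) le_rfl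
  map_isLUB := by
    intro u c hu hc
    refine ⟨?_, fun b hb => iSup₂_le fun x hx => ?_⟩
    · rintro _ ⟨n, rfl⟩
      exact iSup₂_le fun x hx => le_iSup₂_of_le x (hx.trans_le (hc.1 ⟨n, rfl⟩)) le_rfl
    -- Without the intermediate `y` one would only get `x ≤ u n`, not `x ≪ u n`.
    · obtain ⟨y, hxy, hyc⟩ := hS.exists_between hx
      obtain ⟨n, hn⟩ := hyc u c hu hc le_rfl
      exact (le_iSup₂_of_le (f := fun (x : S) (_ : SeqWayBelow x (u n)) => L x) x
        (hxy.trans_le hn) le_rfl).trans (hb ⟨n, rfl⟩)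

variable (hS : IsCuAlmostAlgebraic S) {L : S →+ ℝ≥0∞} (hL : Monotone L)

/-- Together with `hat_regularize_le`, this says that passing from `L` to a functional costs only
the replacement of `s` by some `x ≪ s`. -/
theorem le_hat_regularize {x s : S} (h : SeqWayBelow x s) :
    L x ≤ CuFunctional.hat s (hS.regularize L hL) :=
  le_iSup₂_of_le (f := fun (x : S) (_ : SeqWayBelow x s) => L x) x h le_rfl

theorem hat_regularize_le (s : S) : CuFunctional.hat s (hS.regularize L hL) ≤ L s :=
  iSup₂_le fun _ hx => hL hx.le

end IsCuAlmostAlgebraic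

/-! ### A Hahn–Banach theorem for ordered monoids, with values in `[0,∞]`. -/

section HahnBanach

/-- The largest sublinear map below `q` that is additive in the direction `y`. -/
noncomputable def additiveAlong {M : Type*} [AddCommMonoid M] (q : M → ℝ≥0∞) (y x : M) : ℝ≥0∞ :=
  ⨅ n : ℕ, (q (x + n • y) - n * q y)

theorem additiveAlong_le {M : Type*} [AddCommMonoid M] (q : M → ℝ≥0∞) (y x : M) :
    additiveAlong q y x ≤ q x :=
  (iInf_le _ 0).trans (by simp)

variable {M : Type*} [AddCommMonoid M] [PartialOrder M]

/-- Monotone subadditive maps into `[0,∞]`, positively homogeneous over the natural numbers, that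
are superadditive in the direction `s` with slope at least `c`. -/
structure IsSublinearAlong (s : M) (c : ℝ≥0∞) (q : M → ℝ≥0∞) : Prop where
  mono : Monotone q
  map_zero : q 0 = 0
  subadd : ∀ x y, q (x + y) ≤ q x + q y
  mul_le : ∀ (n : ℕ) x, n * q x ≤ q (n • x)
  add_le : ∀ x, q x + c ≤ q (x + s)

namespace IsSublinearAlong

variable {s : M} {c : ℝ≥0∞} {q : M → ℝ≥0∞}

theorem nsmul_le (h : IsSublinearAlong s c q) (n : ℕ) (x : M) : q (n • x) ≤ n * q x := by
  induction n with
  | zero => simp [h.map_zero]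
  | succ n ih =>
    rw [succ_nsmul, Nat.cast_succ, add_mul, one_mul]
    exact (h.subadd _ _).trans (add_le_add_left ih _)

variable [IsOrderedAddMonoid M]

theorem additiveAlong_add_le (h : IsSublinearAlong s c q) (hM : ∀ x : M, 0 ≤ x) (x y : M) (n : ℕ) :
    additiveAlong q y x + n * q y ≤ q (x + n • y) := by
  refine (add_le_add_left (iInf_le _ n) _).trans (le_of_eq (tsub_add_cancel_of_le ?_))
  exact (h.mul_le n y).trans (h.mono (le_add_of_nonneg_left (hM x)))

/-- The slope is left open as `hd` because two cases occur: the old slope `c` is kept in any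
direction `y`, and along `s` itself it improves to `q s`. -/
theorem additiveAlong (h : IsSublinearAlong s c q) (hM : ∀ x : M, 0 ≤ x) {y : M} (hy : q y ≠ ∞)
    {d : ℝ≥0∞} (hd : ∀ x, additiveAlong q y x + d ≤ additiveAlong q y (x + s)) :
    IsSublinearAlong s d (additiveAlong q y) where
  mono := fun a b hab => iInf_mono fun n => tsub_le_tsub_right (h.mono (by gcongr)) _
  map_zero := le_antisymm ((additiveAlong_le q y 0).trans h.map_zero.le) zero_le
  subadd := by
    intro x z
    refine ENNReal.le_iInf_add_iInf fun n m => ?_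
    refine (iInf_le _ (n + m)).trans ?_
    rw [tsub_le_iff_right]
    calc q (x + z + (n + m) • y) = q ((x + n • y) + (z + m • y)) := by
          rw [add_nsmul]; congr 1; abel
      _ ≤ q (x + n • y) + q (z + m • y) := h.subadd _ _
      _ ≤ ((q (x + n • y) - n * q y) + n * q y) + ((q (z + m • y) - m * q y) + m * q y) :=
          add_le_add le_tsub_add le_tsub_add
      _ = _ := by push_cast; ring
  mul_le := by
    intro k x
    rcases k with _ | k
    · simp
    refine le_iInf fun n => ?_
    have hfin : ∀ m : ℕ, (m : ℝ≥0∞) * q y ≠ ∞ := fun m =>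
      ENNReal.mul_ne_top (ENNReal.natCast_ne_top m) hy
    refine ENNReal.le_sub_of_add_le_right (hfin n) ?_
    -- Multiplying `x + n • y` by `k + 1` creates `k * n` surplus copies of `y`; their finite
    -- contribution is added to both sides and cancelled.
    refine (ENNReal.add_le_add_iff_right (hfin (k * n))).1 ?_
    calc ((k + 1 : ℕ) : ℝ≥0∞) * _root_.additiveAlong q y x + n * q y + (k * n : ℕ) * q y
        = ((k + 1 : ℕ) : ℝ≥0∞) * (_root_.additiveAlong q y x + n * q y) := by push_cast; ring
      _ ≤ ((k + 1 : ℕ) : ℝ≥0∞) * q (x + n • y) := by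
          gcongr; exact h.additiveAlong_add_le hM x y n
      _ ≤ q ((k + 1) • (x + n • y)) := h.mul_le _ _
      _ = q (((k + 1) • x + n • y) + (k * n) • y) := by
          congr 1
          rw [nsmul_add, smul_smul, add_assoc, ← add_nsmul]
          congr 2; ring
      _ ≤ q ((k + 1) • x + n • y) + q ((k * n) • y) := h.subadd _ _
      _ ≤ _ := by gcongr; exact h.nsmul_le _ _
  add_le := hd

theorem additiveAlong_of_slope (h : IsSublinearAlong s c q) (hM : ∀ x : M, 0 ≤ x) {y : M}
    (hy : q y ≠ ∞) : IsSublinearAlong s c (_root_.additiveAlong q y) := by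
  refine h.additiveAlong hM hy fun x => le_iInf fun n => ?_
  refine ENNReal.le_sub_of_add_le_right (ENNReal.mul_ne_top (ENNReal.natCast_ne_top n) hy) ?_
  calc _root_.additiveAlong q y x + c + n * q y
      = (_root_.additiveAlong q y x + n * q y) + c := by ring
    _ ≤ q (x + n • y) + c := by gcongr; exact h.additiveAlong_add_le hM x y n
    _ ≤ q (x + n • y + s) := h.add_le _
    _ = _ := by congr 1; abel

theorem additiveAlong_self (h : IsSublinearAlong s c q) (hM : ∀ x : M, 0 ≤ x) (hs : q s ≠ ∞) :
    IsSublinearAlong s (q s) (_root_.additiveAlong q s) := by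
  refine h.additiveAlong hM hs fun x => le_iInf fun n => ?_
  refine ENNReal.le_sub_of_add_le_right (ENNReal.mul_ne_top (ENNReal.natCast_ne_top n) hs) ?_
  calc _root_.additiveAlong q s x + q s + n * q s
      = _root_.additiveAlong q s x + (n + 1 : ℕ) * q s := by push_cast; ring
    _ ≤ q (x + (n + 1) • s) := h.additiveAlong_add_le hM x s (n + 1)
    _ = _ := by congr 1; rw [succ_nsmul]; abel

/-- Below a sublinear map there is a monotone additive map that still has the prescribed slope. -/
theorem exists_additive_le (h : IsSublinearAlong s c q) (hM : ∀ x : M, 0 ≤ x) :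
    ∃ L : M →+ ℝ≥0∞, Monotone L ∧ c ≤ L s ∧ ∀ x, L x ≤ q x := by
  -- A minimal sublinear map is sought, hence the order dual. The slope condition survives infima of
  -- chains, which keeps the minimal map from collapsing to zero at `s`.
  obtain ⟨m, hmq, hm⟩ := zorn_le_nonempty₀ (α := (M → ℝ≥0∞)ᵒᵈ)
    {p | IsSublinearAlong s c (OrderDual.ofDual p)} (by
      intro C hC hchain p₀ hp₀
      have : Nonempty C := ⟨⟨p₀, hp₀⟩⟩
      have hCC : ∀ p : C, IsSublinearAlong s c (OrderDual.ofDual p.1) := fun p => hC p.2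
      refine ⟨OrderDual.toDual fun x => ⨅ p : C, OrderDual.ofDual p.1 x, ?_, ?_⟩
      · refine ⟨fun a b hab => iInf_mono fun p => (hCC p).mono hab, ?_, fun x y => ?_,
          fun n x => ?_, fun x => ?_⟩
        · exact le_antisymm ((iInf_le _ ⟨p₀, hp₀⟩).trans (hC hp₀).map_zero.le) zero_le
        · refine ENNReal.le_iInf_add_iInf fun p r => ?_
          rcases hchain.total p.2 r.2 with hpr | hpr
          · exact (iInf_le _ r).trans (((hCC r).subadd x y).trans (add_le_add_left (hpr x) _))
          · exact (iInf_le _ p).trans (((hCC p).subadd x y).trans (add_le_add_right (hpr y) _))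
        · refine le_iInf fun p => le_trans ?_ ((hCC p).mul_le n x)
          gcongr
          exact iInf_le _ p
        · refine le_iInf fun p => le_trans ?_ ((hCC p).add_le x)
          gcongr
          exact iInf_le _ p
      · intro p hp x
        exact iInf_le (fun p : C => OrderDual.ofDual p.1 x) ⟨p, hp⟩)
    (OrderDual.toDual q) h
  set r : M → ℝ≥0∞ := OrderDual.ofDual m with hr
  have hrs : IsSublinearAlong s c r := hm.prop
  have hadd : ∀ x y, r (x + y) = r x + r y := by
    intro x y
    refine le_antisymm (hrs.subadd x y) ?_
    -- Where `r y` is infinite, monotonicity suffices. Otherwise minimality gives `r ≤ additiveAlong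
    -- r y`, which is superadditivity in the direction `y`.
    by_cases hy : r y = ∞
    · rw [hy, add_top, ← hy]
      exact hrs.mono (le_add_of_nonneg_left (hM x))
    · have hle : r ≤ _root_.additiveAlong r y :=
        hm.le_of_ge (y := OrderDual.toDual (_root_.additiveAlong r y))
          (hrs.additiveAlong_of_slope hM hy) (fun x => additiveAlong_le r y x)
      have := hrs.additiveAlong_add_le hM x y 1
      simp only [Nat.cast_one, one_mul, one_nsmul] at this
      exact (add_le_add_left (hle x) _).trans this
  refine ⟨⟨⟨r, hrs.map_zero⟩, hadd⟩, hrs.mono, ?_, hmq⟩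
  have := hrs.add_le 0
  rwa [hrs.map_zero, zero_add, zero_add] at this

end IsSublinearAlong

/-- The gauge of `x` relative to `t`: the infimum of `k / n` over all `n • x ≤ k • t`. -/
noncomputable def ratioGauge (t x : M) : ℝ≥0∞ :=
  ⨅ p : {p : ℕ × ℕ // 0 < p.2 ∧ p.2 • x ≤ p.1 • t}, (p.1.1 : ℝ≥0∞) / p.1.2

theorem ratioGauge_le {t x : M} {k n : ℕ} (hn : 0 < n) (h : n • x ≤ k • t) :
    ratioGauge t x ≤ (k : ℝ≥0∞) / n :=
  iInf_le (fun p : {p : ℕ × ℕ // 0 < p.2 ∧ p.2 • x ≤ p.1 • t} => (p.1.1 : ℝ≥0∞) / p.1.2)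
    ⟨(k, n), hn, h⟩

variable [IsOrderedAddMonoid M]

theorem isSublinearAlong_ratioGauge (hM : ∀ x : M, 0 ≤ x) (s t : M) :
    IsSublinearAlong s 0 (ratioGauge t) := by
  have hmono : Monotone (ratioGauge t) := fun a b hab =>
    le_iInf fun p => ratioGauge_le p.2.1 ((nsmul_le_nsmul_right hab _).trans p.2.2)
  refine ⟨hmono, ?_, fun x y => ?_, fun n x => ?_, fun x => ?_⟩
  · refine le_antisymm ?_ zero_le
    simpa using ratioGauge_le (t := t) (x := 0) (k := 0) one_pos (by simp)
  · refine ENNReal.le_iInf_add_iInf fun p r => ?_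
    obtain ⟨⟨k, n⟩, hn, h⟩ := p
    obtain ⟨⟨k', n'⟩, hn', h'⟩ := r
    dsimp only at hn h hn' h' ⊢
    have hn0 : (n : ℝ≥0∞) ≠ 0 := by exact_mod_cast hn.ne'
    have hn0' : (n' : ℝ≥0∞) ≠ 0 := by exact_mod_cast hn'.ne'
    have : (n * n') • (x + y) ≤ (n' * k + n * k') • t := by
      rw [nsmul_add, add_nsmul, mul_comm n n', mul_nsmul', mul_comm n' n, mul_nsmul' y n n',
        mul_nsmul' t n' k, mul_nsmul' t n k']
      gcongr
    refine (ratioGauge_le (Nat.mul_pos hn hn') this).trans (le_of_eq ?_)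
    push_cast
    rw [ENNReal.add_div, ENNReal.mul_div_mul_left _ _ hn0 (by simp),
      mul_comm (n : ℝ≥0∞), ENNReal.mul_div_mul_left _ _ hn0' (by simp)]
  · rcases Nat.eq_zero_or_pos n with rfl | hn
    · simp
    refine le_iInf fun ⟨⟨k, m⟩, hm, h⟩ => ?_
    dsimp only at hm h ⊢
    have hn0 : (n : ℝ≥0∞) ≠ 0 := by exact_mod_cast hn.ne'
    have := ratioGauge_le (t := t) (x := x) (k := k) (Nat.mul_pos hm hn) (by rwa [mul_nsmul'])
    calc (n : ℝ≥0∞) * ratioGauge t x ≤ n * (k / (m * n : ℕ)) := by gcongr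
      _ = k / m := by
        push_cast
        rw [← mul_div_assoc, mul_comm (m : ℝ≥0∞), ENNReal.mul_div_mul_left _ _ hn0 (by simp)]
  · rw [add_zero]
    exact hmono (le_add_of_nonneg_right (hM s))

/-- A monotone additive map that maximizes the value at `s` among those with value at most `1`
at `t`. -/
theorem exists_additive_ratioGauge_le (hM : ∀ x : M, 0 ≤ x) (s t : M) :
    ∃ L : M →+ ℝ≥0∞, Monotone L ∧ ratioGauge t s ≤ L s ∧ L t ≤ 1 := by
  have ht : ratioGauge t t ≤ 1 := by
    simpa using ratioGauge_le (t := t) (x := t) (k := 1) one_pos le_rfl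
  have h := isSublinearAlong_ratioGauge hM s t
  by_cases hs : ratioGauge t s = ∞
  · have h' : IsSublinearAlong s ∞ (ratioGauge t) := by
      refine ⟨h.mono, h.map_zero, h.subadd, h.mul_le, fun x => ?_⟩
      rw [add_top, ← hs]
      exact h.mono (le_add_of_nonneg_left (hM x))
    obtain ⟨L, hL, hLs, hLq⟩ := h'.exists_additive_le hM
    exact ⟨L, hL, hs ▸ hLs, (hLq t).trans ht⟩
  · obtain ⟨L, hL, hLs, hLq⟩ := (h.additiveAlong_self hM hs).exists_additive_le hM
    exact ⟨L, hL, hLs, (hLq t).trans ((additiveAlong_le _ _ _).trans ht)⟩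

end HahnBanach

/-! ### From pointwise inequalities on `F(S)` to inequalities in `S`. -/

/-- If `ŝ ≤ t̂`, then multiples of elements `x ≪ s` are dominated by multiples of `t`. -/
theorem IsCuAlmostAlgebraic.exists_nsmul_le {S : Type*} [AddCommMonoid S] [PartialOrder S]
    [IsOrderedAddMonoid S] (hS : IsCuAlmostAlgebraic S) {x s t : S} (hx : SeqWayBelow x s)
    (hst : ∀ l : CuFunctional S, CuFunctional.hat s l ≤ CuFunctional.hat t l) {A B : ℕ}
    (hBA : B < A) : ∃ p q : ℕ, B * q < A * p ∧ p • x ≤ q • t := by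
  by_contra! hcon
  -- If no `p`, `q` exist, then `A * p ≤ B * q` whenever `p • x ≤ q • t`, so the gauge of `x`
  -- exceeds `1`. But regularizing `L` and using `ŝ ≤ t̂` gives `L x ≤ L t ≤ 1`. For `B = 0` the
  -- gauge is an empty infimum.
  obtain ⟨L, hL, hLs, hLt⟩ := exists_additive_ratioGauge_le hS.zero_le x t
  have h1 : L x ≤ 1 := (hS.le_hat_regularize hL hx).trans
    ((hst _).trans ((hS.hat_regularize_le hL t).trans hLt))
  have hA : (A : ℝ≥0∞) ≤ B := by
    calc (A : ℝ≥0∞) ≤ B * ratioGauge t x := by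
          rw [ratioGauge]
          by_cases hB : B = 0
          · subst hB
            have : IsEmpty {p : ℕ × ℕ // 0 < p.2 ∧ p.2 • x ≤ p.1 • t} := by
              refine ⟨fun ⟨⟨k, n⟩, hn, h⟩ => hcon n k ?_ h⟩
              rw [zero_mul]
              exact Nat.mul_pos (by omega) hn
            have h2 : L x = ∞ := by
              rw [eq_top_iff]
              refine le_trans ?_ hLs
              simp [ratioGauge]
            simp [h2] at h1
          · rw [ENNReal.mul_iInf_of_ne (by exact_mod_cast hB) (by simp)]
            refine le_iInf fun ⟨⟨k, n⟩, hn, h⟩ => ?_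
            dsimp only at hn h ⊢
            have : A * n ≤ B * k := by
              by_contra! hlt
              exact hcon n k hlt h
            rw [← mul_div_assoc, ENNReal.le_div_iff_mul_le (by left; exact_mod_cast hn.ne')
              (by left; simp)]
            exact_mod_cast this
      _ ≤ B * 1 := by gcongr; exact hLs.trans h1
      _ = B := mul_one _
  exact absurd (Nat.cast_le.1 hA) (by omega)

/-! ### Compactness of `F(S)` and compact containment of functions `ŝ / n`. -/

section Realification

open Filter Topology NNReal

variable {S : Type*} [AddCommMonoid S] [PartialOrder S]

namespace CuFunctional

theorem hat_mono (l : CuFunctional S) {s t : S} (h : s ≤ t) : hat s l ≤ hat t l := l.mono h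

theorem hat_add (l : CuFunctional S) (s t : S) : hat (s + t) l = hat s l + hat t l :=
  l.toAddMonoidHom.map_add s t

theorem hat_nsmul (l : CuFunctional S) (n : ℕ) (s : S) : hat (n • s) l = n * hat s l := by
  simp [hat]

theorem hat_eq_iSup (l : CuFunctional S) {u : ℕ → S} {c : S} (hu : Monotone u)
    (hc : IsLUB (Set.range u) c) : hat c l = ⨆ n, hat (u n) l :=
  (l.map_isLUB u c hu hc).iSup_eq.symm

/-- Multiplication of a functional by a constant. -/
noncomputable def scale (c : ℝ≥0∞) (l : CuFunctional S) : CuFunctional S where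
  toAddMonoidHom := (AddMonoidHom.mulLeft c).comp l.toAddMonoidHom
  mono := fun s t h => by
    simp only [AddMonoidHom.comp_apply, AddMonoidHom.coe_mulLeft]
    gcongr
    exact l.mono h
  map_isLUB := by
    intro u d hu hd
    simp only [AddMonoidHom.comp_apply, AddMonoidHom.coe_mulLeft]
    rw [← (l.map_isLUB u d hu hd).iSup_eq, ENNReal.mul_iSup]
    exact isLUB_iSup

theorem hat_scale (c : ℝ≥0∞) (l : CuFunctional S) (s : S) : hat s (scale c l) = c * hat s l := rfl

end CuFunctional

open CuFunctional

/-- The functions of the form `ŝ / n`. -/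
def IsHatQuotient (φ : CuFunctional S → ℝ≥0∞) : Prop :=
  ∃ (s : S) (n : ℕ), 0 < n ∧ φ = fun l => hat s l / n

theorem mem_realification_iff {f : CuFunctional S → ℝ≥0∞} :
    f ∈ realification S ↔
      ∃ b : ℕ → CuFunctional S → ℝ≥0∞, (∀ i, IsHatQuotient (b i)) ∧ Monotone b ∧ f = ⨆ i, b i := by
  constructor
  · rintro ⟨s, n, hn, hm, hf⟩
    exact ⟨_, fun i => ⟨s i, n i, hn i, rfl⟩, hm, funext fun l => by rw [hf, iSup_apply]⟩
  · rintro ⟨b, hb, hm, hf⟩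
    choose s n hn hbe using hb
    refine ⟨s, n, hn, ?_, fun l => ?_⟩
    · exact fun i j hij => by simpa only [hbe] using hm hij
    · rw [hf, iSup_apply]
      simp only [hbe]

namespace IsHatQuotient

theorem mem {φ : CuFunctional S → ℝ≥0∞} (h : IsHatQuotient φ) : φ ∈ realification S :=
  mem_realification_iff.2 ⟨fun _ => φ, fun _ => h, monotone_const, by simp⟩

theorem add {φ ψ : CuFunctional S → ℝ≥0∞} (hφ : IsHatQuotient φ) (hψ : IsHatQuotient ψ) :
    IsHatQuotient (φ + ψ) := by
  obtain ⟨s, n, hn, rfl⟩ := hφ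
  obtain ⟨t, m, hm, rfl⟩ := hψ
  refine ⟨m • s + n • t, n * m, Nat.mul_pos hn hm, funext fun l => ?_⟩
  have hn0 : (n : ℝ≥0∞) ≠ 0 := by exact_mod_cast hn.ne'
  have hm0 : (m : ℝ≥0∞) ≠ 0 := by exact_mod_cast hm.ne'
  rw [Pi.add_apply, hat_add, hat_nsmul, hat_nsmul, Nat.cast_mul, ENNReal.add_div,
    ENNReal.mul_div_mul_left _ _ hn0 (by simp), mul_comm (n : ℝ≥0∞) (m : ℝ≥0∞),
    ENNReal.mul_div_mul_left _ _ hm0 (by simp)]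

theorem sum {ι : Type*} {φ : ι → CuFunctional S → ℝ≥0∞} (h : ∀ i, IsHatQuotient (φ i))
    (A : Finset ι) : IsHatQuotient (∑ i ∈ A, φ i) := by
  classical
  induction A using Finset.induction_on with
  | empty => exact ⟨0, 1, one_pos, funext fun l => by simp [hat]⟩
  | insert a A ha ih => rw [Finset.sum_insert ha]; exact (h a).add ih

theorem div {φ : CuFunctional S → ℝ≥0∞} (h : IsHatQuotient φ) {k : ℕ} (hk : 0 < k) :
    IsHatQuotient fun l => φ l / k := by
  obtain ⟨s, n, hn, rfl⟩ := h
  refine ⟨s, n * k, Nat.mul_pos hn hk, funext fun l => ?_⟩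
  simp only [Nat.cast_mul, div_eq_mul_inv]
  rw [mul_assoc,
    ENNReal.mul_inv (by right; simp) (by left; simp)]

end IsHatQuotient

theorem apply_scale_of_mem_realification {f : CuFunctional S → ℝ≥0∞} (hf : f ∈ realification S)
    (c : ℝ≥0∞) (l : CuFunctional S) : f (scale c l) = c * f l := by
  obtain ⟨s, n, -, -, hf⟩ := hf
  rw [hf, hf, ENNReal.mul_iSup]
  simp only [hat_scale, mul_div_assoc]

/-- Compact containment of functions on `F(S)` with respect to pointwise suprema of increasing
sequences in the realification. -/
def PointwiseWayBelow (φ ψ : CuFunctional S → ℝ≥0∞) : Prop :=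
  ∀ u : ℕ → CuFunctional S → ℝ≥0∞, (∀ n, u n ∈ realification S) → Monotone u →
    ψ ≤ ⨆ n, u n → ∃ n, φ ≤ u n

namespace PointwiseWayBelow

variable {φ ψ χ : CuFunctional S → ℝ≥0∞}

theorem le (h : PointwiseWayBelow φ ψ) (hψ : ψ ∈ realification S) : φ ≤ ψ := by
  obtain ⟨_, h⟩ := h (fun _ => ψ) (fun _ => hψ) monotone_const (by simp)
  exact h

theorem trans_le (h : PointwiseWayBelow φ ψ) (h' : ψ ≤ χ) : PointwiseWayBelow φ χ :=
  fun u hu hm hc => h u hu hm (h'.trans hc)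

theorem of_le (h : φ ≤ ψ) (h' : PointwiseWayBelow ψ χ) : PointwiseWayBelow φ χ := by
  intro u hu hm hc
  obtain ⟨n, hn⟩ := h' u hu hm hc
  exact ⟨n, h.trans hn⟩

end PointwiseWayBelow

/-- Every sequence of functionals has a cluster point. -/
theorem IsCuAlmostAlgebraic.exists_clusterPoint [IsOrderedAddMonoid S] (hS : IsCuAlmostAlgebraic S)
    (l : ℕ → CuFunctional S) :
    ∃ l₀ : CuFunctional S,
      (∀ x s : S, SeqWayBelow x s → ∀ c, (∀ n, c ≤ hat x (l n)) → c ≤ hat s l₀) ∧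
      ∀ f ∈ realification S, ∀ c, (∀ᶠ n in atTop, f (l n) ≤ c) → f l₀ ≤ c := by
  -- Pointwise limits along a nonprincipal ultrafilter exist by compactness of `[0,∞]`. The limit is
  -- additive and monotone but may fail to preserve suprema, hence the regularization.
  set U : Ultrafilter ℕ := hyperfilter ℕ
  have hU : ∀ s : S, ∃ a, Tendsto (fun n => hat s (l n)) U (𝓝 a) := fun s =>
    ⟨_, Ultrafilter.le_nhds_lim (U.map fun n => hat s (l n))⟩
  choose L hL using hU
  let L' : S →+ ℝ≥0∞ :=
    { toFun := L
      map_zero' := tendsto_nhds_unique (hL 0) (by simp [hat])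
      map_add' := fun s t => tendsto_nhds_unique (hL (s + t)) (by
        simpa only [hat_add] using (hL s).add (hL t)) }
  have hmono : Monotone L' := fun s t hst =>
    le_of_tendsto_of_tendsto' (hL s) (hL t) fun n => hat_mono _ hst
  refine ⟨hS.regularize L' hmono, fun x s hxs c hc => ?_, fun f hf c hc => ?_⟩
  · exact (ge_of_tendsto' (hL x) hc).trans (hS.le_hat_regularize hmono hxs)
  · obtain ⟨s, n, hn, -, hf⟩ := hf
    rw [hf]
    refine iSup_le fun i => ?_
    have hn0 : (n i : ℝ≥0∞) ≠ 0 := by exact_mod_cast (hn i).ne'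
    rw [ENNReal.div_le_iff_le_mul (Or.inl hn0) (Or.inl (by simp))]
    refine (hS.hat_regularize_le hmono _).trans (le_of_tendsto (hL (s i)) ?_)
    have hc' : ∀ᶠ n in (U : Filter ℕ), f (l n) ≤ c :=
      (Nat.hyperfilter_le_atTop : (U : Filter ℕ) ≤ atTop) hc
    filter_upwards [hc'] with k hk
    rw [← ENNReal.div_le_iff_le_mul (Or.inl hn0) (Or.inl (by simp))]
    refine le_trans ?_ hk
    rw [hf]
    exact le_iSup (fun i => hat (s i) (l k) / (n i : ℝ≥0∞)) i

/-- If every `u n` fails to dominate, homogeneity rescales the witnesses to `u n (l n) ≤ a` and `x̂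
(l n) ≥ 1`. A cluster point `l₀` then has `ŝ(l₀) ≥ 1` and `sup u ≤ a` there, forcing `b ≤ a`. -/
theorem IsCuAlmostAlgebraic.pointwiseWayBelow_of_lt [IsOrderedAddMonoid S] (hS : IsCuAlmostAlgebraic S) {x s : S}
    (h : SeqWayBelow x s) {a b : ℝ≥0∞} (hab : a < b) :
    PointwiseWayBelow (fun l => a * hat x l) (fun l => b * hat s l) := by
  intro u hu hm hle
  by_contra! hcon
  have hex : ∀ n, ∃ l : CuFunctional S, u n l ≤ a ∧ 1 ≤ hat x l := by
    intro n
    have hn := hcon n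
    rw [Pi.le_def, not_forall] at hn
    obtain ⟨l, hl⟩ := hn
    rw [not_le] at hl
    have ha : a ≠ 0 := by rintro rfl; simp at hl
    have hx : hat x l ≠ 0 := by intro h0; simp [h0] at hl
    by_cases htop : hat x l = ∞
    -- Here `u n l` is finite but possibly zero, hence the `+ 1`; a nonzero factor keeps `x̂`
    -- infinite.
    · refine ⟨scale (a / (u n l + 1)) l, ?_, ?_⟩
      · rw [apply_scale_of_mem_realification (hu n)]
        calc a / (u n l + 1) * u n l ≤ a / (u n l + 1) * (u n l + 1) := by
              gcongr; exact le_self_add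
          _ ≤ a := by
            rw [mul_comm]
            exact ENNReal.mul_div_le
      · rw [hat_scale, htop, ENNReal.mul_top]
        · exact le_top
        · exact ENNReal.div_ne_zero.2 ⟨ha, by simp [(hl.trans_le le_top).ne]⟩
    · refine ⟨scale (hat x l)⁻¹ l, ?_, ?_⟩
      · rw [apply_scale_of_mem_realification (hu n)]
        calc (hat x l)⁻¹ * u n l ≤ (hat x l)⁻¹ * (a * hat x l) := by gcongr
          _ = a := by rw [mul_comm a, ← mul_assoc, ENNReal.inv_mul_cancel hx htop, one_mul]
      · rw [hat_scale, ENNReal.inv_mul_cancel hx htop]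
  choose l hl1 hl2 using hex
  obtain ⟨l₀, hlow, hupp⟩ := hS.exists_clusterPoint l
  have h1 : 1 ≤ hat s l₀ := hlow x s h 1 hl2
  have h2 : (⨆ n, u n) l₀ ≤ a := by
    rw [iSup_apply]
    refine iSup_le fun m => hupp _ (hu m) a ?_
    filter_upwards [eventually_ge_atTop m] with n hn
    exact (hm hn _).trans (hl1 n)
  have h3 : b ≤ a := calc
    b = b * 1 := (mul_one b).symm
    _ ≤ b * hat s l₀ := by gcongr
    _ ≤ a := (hle l₀).trans h2
  exact absurd hab h3.not_gt

/-- The factors `(k + 1) / (k + 2)`, increasing to `1`. -/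
noncomputable def approxFactor (k : ℕ) : ℝ≥0∞ := ((k + 1 : ℕ) : ℝ≥0∞) / (k + 2 : ℕ)

theorem approxFactor_add_inv (k : ℕ) : approxFactor k + ((k + 2 : ℕ) : ℝ≥0∞)⁻¹ = 1 := by
  rw [approxFactor, ← one_div, ENNReal.div_add_div_same, ← Nat.cast_succ]
  exact ENNReal.div_self (by simp) (by simp)

theorem approxFactor_strictMono : StrictMono approxFactor := by
  refine strictMono_nat_of_lt_succ fun k => ?_
  by_contra! hle
  have h1 : (((k + 1) + 2 : ℕ) : ℝ≥0∞)⁻¹ < ((k + 2 : ℕ) : ℝ≥0∞)⁻¹ :=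
    ENNReal.inv_lt_inv.2 (by exact_mod_cast (by omega))
  have hfin : approxFactor (k + 1) ≠ ∞ := by
    intro h
    have := approxFactor_add_inv (k + 1)
    simp [h] at this
  have := ENNReal.add_lt_add_of_le_of_lt hfin hle h1
  rw [approxFactor_add_inv, approxFactor_add_inv] at this
  exact lt_irrefl _ this

theorem iSup_approxFactor : ⨆ k, approxFactor k = 1 := by
  refine le_antisymm (iSup_le fun k => ?_) ?_
  · rw [← approxFactor_add_inv k]; exact le_self_add
  · have h : Tendsto (fun k : ℕ => (⨆ k, approxFactor k) + ((k + 2 : ℕ) : ℝ≥0∞)⁻¹) atTop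
        (𝓝 ((⨆ k, approxFactor k) + 0)) :=
      tendsto_const_nhds.add (ENNReal.tendsto_inv_nat_nhds_zero.comp (tendsto_add_atTop_nat 2))
    rw [add_zero] at h
    refine ge_of_tendsto' h fun k => ?_
    rw [← approxFactor_add_inv k]
    gcongr
    exact le_iSup approxFactor k

/-- The approximants `(k + 1) / (k + 2) * û_k / n` of `ŝ / n`, for `u` rapidly increasing to `s`. -/
noncomputable def hatApprox (u : ℕ → S) (n k : ℕ) (l : CuFunctional S) : ℝ≥0∞ :=
  hat ((k + 1) • u k) l / ((k + 2) * n : ℕ)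

theorem isHatQuotient_hatApprox (u : ℕ → S) {n : ℕ} (hn : 0 < n) (k : ℕ) :
    IsHatQuotient (hatApprox u n k) :=
  ⟨_, _, Nat.mul_pos (by omega) hn, rfl⟩

theorem hatApprox_eq (u : ℕ → S) (n k : ℕ) (l : CuFunctional S) :
    hatApprox u n k l = (n : ℝ≥0∞)⁻¹ * approxFactor k * hat (u k) l := by
  rw [hatApprox, hat_nsmul, Nat.cast_mul, approxFactor, div_eq_mul_inv, div_eq_mul_inv,
    ENNReal.mul_inv (by right; simp) (by left; simp)]
  ring

theorem IsCuAlmostAlgebraic.hatApprox_wayBelow [IsOrderedAddMonoid S] (hS : IsCuAlmostAlgebraic S) {u : ℕ → S}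
    (hu : ∀ n, SeqWayBelow (u n) (u (n + 1))) {n : ℕ} (hn : 0 < n) (k : ℕ) :
    PointwiseWayBelow (hatApprox u n k) (hatApprox u n (k + 1)) := by
  have := hS.pointwiseWayBelow_of_lt (hu k)
    (ENNReal.mul_lt_mul_right (a := (n : ℝ≥0∞)⁻¹) (by simp) (by simp [hn.ne'])
      (approxFactor_strictMono k.lt_succ_self))
  convert this using 1
  · exact funext fun l => hatApprox_eq u n k l
  · exact funext fun l => hatApprox_eq u n (k + 1) l

theorem iSup_hatApprox {u : ℕ → S} {s : S} (hu : Monotone u) (hs : IsLUB (Set.range u) s) (n : ℕ) :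
    ⨆ k, hatApprox u n k = fun l => hat s l / n := by
  funext l
  rw [iSup_apply]
  simp only [hatApprox_eq, hat_eq_iSup l hu hs]
  simp only [mul_assoc]
  rw [← ENNReal.mul_iSup, div_eq_mul_inv, mul_comm _ (n : ℝ≥0∞)⁻¹]
  congr 1
  refine le_antisymm (iSup_le fun k => ?_) ?_
  · refine (mul_le_of_le_one_left zero_le ?_).trans (le_iSup (fun k => hat (u k) l) k)
    exact (le_iSup approxFactor k).trans iSup_approxFactor.le
  · rw [← one_mul (⨆ n, hat (u n) l), ← iSup_approxFactor, ENNReal.iSup_mul]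
    refine iSup_le fun i => ?_
    rw [ENNReal.mul_iSup]
    refine iSup_le fun j => le_iSup_of_le (max i j) ?_
    exact mul_le_mul' (approxFactor_strictMono.monotone (le_max_left i j))
      (hat_mono l (hu (le_max_right i j)))

end Realification

/-! ### Suprema and compact containment in the realification. -/

section Realification

open CuFunctional

variable {S : Type*} [AddCommMonoid S] [PartialOrder S] [IsOrderedAddMonoid S]

/-- The supremum of an increasing sequence in the realification is also the supremum of a rapidly
increasing sequence of functions `ŝ / n`. -/
theorem IsCuAlmostAlgebraic.exists_wayBelow_seq (hS : IsCuAlmostAlgebraic S)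
    {u : ℕ → CuFunctional S → ℝ≥0∞} (hu : ∀ n, u n ∈ realification S) (hm : Monotone u) :
    ∃ c : ℕ → CuFunctional S → ℝ≥0∞, (∀ k, IsHatQuotient (c k)) ∧
      (∀ k, PointwiseWayBelow (c k) (c (k + 1))) ∧ ⨆ n, u n = ⨆ k, c k := by
  have hq : ∀ φ : CuFunctional S → ℝ≥0∞, IsHatQuotient φ →
      ∃ e : ℕ → CuFunctional S → ℝ≥0∞, (∀ k, IsHatQuotient (e k)) ∧
        (∀ k, PointwiseWayBelow (e k) (e (k + 1))) ∧ φ = ⨆ k, e k := by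
    rintro _ ⟨s, n, hn, rfl⟩
    obtain ⟨v, hv, hs⟩ := hS.O2 s
    exact ⟨hatApprox v n, isHatQuotient_hatApprox v hn, hS.hatApprox_wayBelow hv hn,
      (iSup_hatApprox (SeqWayBelow.monotone hv) hs n).symm⟩
  choose b hbq hbm hub using fun n => mem_realification_iff.1 (hu n)
  choose e heq hew hbe using fun n i => hq (b n i) (hbq n i)
  have hem : ∀ n i, Monotone (e n i) := fun n i =>
    monotone_nat_of_le_succ fun k => (hew n i k).le (heq n i _).mem
  -- Two of the three steps `k`, `k + 1`, `k + 2` absorb the suprema over `I` and `K`. The threshold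
  -- for `K` depends on `I`, so the triples are directed but not cofinal along a diagonal; a chain
  -- is extracted from an enumeration.
  have hev : ∀ n i k N, n ≤ N → ∃ I₀, ∀ I, I₀ ≤ I → ∃ K₀, ∀ K, K₀ ≤ K →
      PointwiseWayBelow (e n i k) (e N I K) := by
    intro n i k N hnN
    have h1 : e n i (k + 2) ≤ ⨆ I, b N I := by
      rw [← hub N]
      refine le_trans ?_ (hm hnN)
      rw [hub n]
      refine le_trans ?_ (le_iSup (b n) i)
      rw [hbe n i]
      exact le_iSup (e n i) (k + 2)
    obtain ⟨I₀, hI₀⟩ := hew n i (k + 1) (b N) (fun I => (hbq N I).mem) (hbm N) h1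
    refine ⟨I₀, fun I hI => ?_⟩
    have h2 : e n i (k + 1) ≤ ⨆ K, e N I K := by
      rw [← hbe N I]
      exact hI₀.trans (hbm N hI)
    obtain ⟨K₀, hK₀⟩ := hew n i k (e N I) (fun K => (heq N I K).mem) (hem N I) h2
    refine ⟨K₀ + 1, fun K hK => ?_⟩
    exact (PointwiseWayBelow.of_le hK₀ (hew N I K₀)).trans_le (hem N I hK)
  let E : ℕ × ℕ × ℕ → CuFunctional S → ℝ≥0∞ := fun p => e p.1 p.2.1 p.2.2
  have hdir : ∀ p r, ∃ t, PointwiseWayBelow (E p) (E t) ∧ PointwiseWayBelow (E r) (E t) := by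
    rintro ⟨n, i, k⟩ ⟨n', i', k'⟩
    obtain ⟨I, hI⟩ := hev n i k (max n n') (le_max_left _ _)
    obtain ⟨I', hI'⟩ := hev n' i' k' (max n n') (le_max_right _ _)
    obtain ⟨K, hK⟩ := hI (max I I') (le_max_left _ _)
    obtain ⟨K', hK'⟩ := hI' (max I I') (le_max_right _ _)
    exact ⟨(max n n', max I I', max K K'), hK _ (le_max_left _ _), hK' _ (le_max_right _ _)⟩
  choose d hd1 hd2 using hdir
  obtain ⟨enum, henum⟩ := exists_surjective_nat (ℕ × ℕ × ℕ)
  let idx : ℕ → ℕ × ℕ × ℕ := fun k => Nat.rec (0, 0, 0) (fun j p => d p (enum j)) k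
  refine ⟨fun k => E (idx k), fun k => heq _ _ _, fun k => hd1 _ _, le_antisymm ?_ ?_⟩
  · refine iSup_le fun n => ?_
    rw [hub n]
    refine iSup_le fun i => ?_
    rw [hbe n i]
    refine iSup_le fun k => ?_
    obtain ⟨j, hj⟩ := henum (n, i, k)
    refine le_iSup_of_le (j + 1) (le_trans ?_ ((hd2 (idx j) (enum j)).le (heq _ _ _).mem))
    rw [hj]
  · refine iSup_le fun k => le_iSup_of_le (idx k).1 ?_
    rw [hub]
    refine le_iSup_of_le (idx k).2.1 ?_
    rw [hbe]
    exact le_iSup (e (idx k).1 (idx k).2.1) (idx k).2.2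

theorem IsCuAlmostAlgebraic.iSup_mem_realification (hS : IsCuAlmostAlgebraic S)
    {u : ℕ → CuFunctional S → ℝ≥0∞} (hu : ∀ n, u n ∈ realification S) (hm : Monotone u) :
    ⨆ n, u n ∈ realification S := by
  obtain ⟨c, hc, hw, he⟩ := hS.exists_wayBelow_seq hu hm
  exact mem_realification_iff.2
    ⟨c, hc, monotone_nat_of_le_succ fun k => (hw k).le (hc _).mem, he⟩

theorem IsCuAlmostAlgebraic.isLUB_realification_iff (hS : IsCuAlmostAlgebraic S)
    {u : ℕ → realification S} (hm : Monotone u) {c : realification S} :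
    IsLUB (Set.range u) c ↔ (c : CuFunctional S → ℝ≥0∞) = ⨆ n, (u n : CuFunctional S → ℝ≥0∞) := by
  have hlub : IsLUB (Set.range u) ⟨⨆ n, (u n : CuFunctional S → ℝ≥0∞),
      hS.iSup_mem_realification (fun n => (u n).2) hm⟩ := by
    constructor
    · rintro _ ⟨n, rfl⟩
      exact le_iSup (fun n => (u n : CuFunctional S → ℝ≥0∞)) n
    · intro b hb
      exact iSup_le (α := CuFunctional S → ℝ≥0∞) fun n => hb ⟨n, rfl⟩
  constructor
  · intro hc
    rw [hc.unique hlub]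
  · intro hc
    convert hlub

theorem IsCuAlmostAlgebraic.seqWayBelow_realification_iff (hS : IsCuAlmostAlgebraic S)
    {f g : realification S} :
    SeqWayBelow f g ↔
      PointwiseWayBelow (f : CuFunctional S → ℝ≥0∞) (g : CuFunctional S → ℝ≥0∞) := by
  constructor
  · intro h u hu hm hle
    exact h (fun n => ⟨u n, hu n⟩) ⟨_, hS.iSup_mem_realification hu hm⟩ hm
      ((hS.isLUB_realification_iff hm).2 rfl) hle
  · intro h u c hm hc hle
    refine h (fun n => (u n : CuFunctional S → ℝ≥0∞)) (fun n => (u n).2) hm ?_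
    rw [← (hS.isLUB_realification_iff hm).1 hc]
    exact hle

/-- Compact containment in the realification is witnessed by compact containment in `S`. -/
theorem IsCuAlmostAlgebraic.exists_hat_between (hS : IsCuAlmostAlgebraic S)
    {f g : CuFunctional S → ℝ≥0∞} (hg : g ∈ realification S) (h : PointwiseWayBelow f g) :
    ∃ (u : ℕ → S) (s : S) (n A B : ℕ), (∀ k, SeqWayBelow (u k) (u (k + 1))) ∧
      (∀ k, SeqWayBelow (u k) s) ∧ 0 < n ∧ B < A ∧
      PointwiseWayBelow f (fun l => hat (B • u 0) l / (A * n : ℕ)) ∧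
      PointwiseWayBelow (fun l => hat s l / n) g := by
  obtain ⟨c, hc, hw, he⟩ := hS.exists_wayBelow_seq (u := fun _ => g) (fun _ => hg) monotone_const
  rw [ciSup_const] at he
  have hcm : Monotone c := monotone_nat_of_le_succ fun k => (hw k).le (hc _).mem
  obtain ⟨k, hk⟩ := h c (fun k => (hc k).mem) hcm he.le
  obtain ⟨s, n, hn, hs⟩ := hc (k + 2)
  obtain ⟨u, hu, hus⟩ := hS.O2 s
  obtain ⟨j, hj⟩ := hw (k + 1) (hatApprox u n) (fun j => (isHatQuotient_hatApprox u hn j).mem)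
    (monotone_nat_of_le_succ fun j =>
      (hS.hatApprox_wayBelow hu hn j).le (isHatQuotient_hatApprox u hn _).mem)
    (by rw [iSup_hatApprox (SeqWayBelow.monotone hu) hus, hs])
  -- The ratio `B / A` is the factor `(j + 1) / (j + 2)` of `hatApprox u n j`, and the sequence is
  -- shifted to start at `u j`.
  refine ⟨fun i => u (j + i), s, n, j + 2, j + 1, fun i => hu _,
    fun i => SeqWayBelow.of_isLUB hu hus _, hn, by omega, ?_, ?_⟩
  · exact (PointwiseWayBelow.of_le hk (hw k)).trans_le hj
  · rw [← hs]
    exact (hw (k + 2)).trans_le (he ▸ le_iSup c (k + 3))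

end Realification

/-! ### Dyadic Riemann sums in `[0,∞]`. -/

section DyadicMean

open Filter Topology

/-- The mean of the first `2 ^ N` terms. -/
noncomputable def dyadicMean (N : ℕ) (φ : ℕ → ℝ≥0∞) : ℝ≥0∞ :=
  (∑ a ∈ Finset.range (2 ^ N), φ a) / (2 ^ N : ℕ)

theorem dyadicMean_add (N : ℕ) (φ ψ : ℕ → ℝ≥0∞) :
    dyadicMean N φ + dyadicMean N ψ = dyadicMean N fun a => φ a + ψ a := by
  rw [dyadicMean, dyadicMean, dyadicMean, Finset.sum_add_distrib, ENNReal.add_div]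

theorem dyadicMean_mono (N : ℕ) {φ ψ : ℕ → ℝ≥0∞} (h : ∀ a, φ a ≤ ψ a) :
    dyadicMean N φ ≤ dyadicMean N ψ :=
  ENNReal.div_le_div_right (Finset.sum_le_sum fun a _ => h a) _

theorem dyadicMean_const (N : ℕ) (c : ℝ≥0∞) : dyadicMean N (fun _ => c) = c := by
  rw [dyadicMean, Finset.sum_const, Finset.card_range, nsmul_eq_mul]
  rw [mul_div_assoc]
  exact ENNReal.mul_div_cancel (by simp) (ENNReal.natCast_ne_top _)

theorem dyadicMean_eq_top (N : ℕ) {φ : ℕ → ℝ≥0∞} (h : ∀ a, φ a = ∞) : dyadicMean N φ = ∞ := by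
  rw [funext h, dyadicMean_const]

theorem sum_range_two_mul {M : Type*} [AddCommMonoid M] (n : ℕ) (φ : ℕ → M) :
    ∑ a ∈ Finset.range (2 * n), φ a = ∑ a ∈ Finset.range n, (φ (2 * a) + φ (2 * a + 1)) := by
  induction n with
  | zero => simp
  | succ n ih =>
    rw [Nat.mul_succ, Finset.sum_range_succ, Finset.sum_range_succ, ih, Finset.sum_range_succ,
      add_assoc]

theorem monotone_dyadicMean {φ : ℕ → ℕ → ℝ≥0∞} (h0 : ∀ N a, φ N a ≤ φ (N + 1) (2 * a))
    (h1 : ∀ N a, φ N a ≤ φ (N + 1) (2 * a + 1)) : Monotone fun N => dyadicMean N (φ N) := by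
  refine monotone_nat_of_le_succ fun N => ?_
  have h2 : (∑ a ∈ Finset.range (2 ^ (N + 1)), φ (N + 1) a) ≥
      2 * ∑ a ∈ Finset.range (2 ^ N), φ N a := by
    rw [pow_succ', sum_range_two_mul, Finset.mul_sum]
    refine Finset.sum_le_sum fun a _ => ?_
    rw [two_mul]
    exact add_le_add (h0 N a) (h1 N a)
  calc dyadicMean N (φ N)
      = (2 * ∑ a ∈ Finset.range (2 ^ N), φ N a) / (2 * (2 ^ N : ℕ)) := by
        rw [ENNReal.mul_div_mul_left _ _ (by simp) (by simp), dyadicMean]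
    _ ≤ dyadicMean (N + 1) (φ (N + 1)) := by
        rw [dyadicMean, pow_succ', Nat.cast_mul, Nat.cast_ofNat, ← pow_succ']
        exact ENNReal.div_le_div_right h2 _

/-- The shift brings in `k` new terms, each at most `M`; after division by `2 ^ N` this error
vanishes in the limit. -/
theorem sum_range_shift_le {φ : ℕ → ℝ≥0∞} {M : ℝ≥0∞} (h : ∀ a, φ a ≤ M) (n k : ℕ) :
    ∑ a ∈ Finset.range n, φ (a + k) ≤ ∑ a ∈ Finset.range n, φ a + k * M := by
  induction k with
  | zero => simp
  | succ k ih =>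
    calc ∑ a ∈ Finset.range n, φ (a + (k + 1))
        ≤ ∑ a ∈ Finset.range (n + 1), φ (a + k) := by
          rw [Finset.sum_range_succ']
          exact le_add_of_le_of_nonneg
            (le_of_eq (Finset.sum_congr rfl fun a _ => by congr 1; ring)) zero_le
      _ = ∑ a ∈ Finset.range n, φ (a + k) + φ (n + k) := Finset.sum_range_succ _ _
      _ ≤ (∑ a ∈ Finset.range n, φ a + k * M) + M := add_le_add ih (h _)
      _ = _ := by push_cast; ring

/-- Riemann sums of an increasing dyadic family `D`, and of a family `V` of approximate complements
of `D` in `τ`, converge to complementary values. -/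
theorem iSup_dyadicMean_add {D V : ℕ → ℕ → ℝ≥0∞} {τ : ℕ → ℝ≥0∞} {M : ℝ≥0∞}
    (hDmono : ∀ N, Monotone (D N)) (hD : ∀ N a, D (N + 1) (2 * a) = D N a)
    (hDM : ∀ N a, D N a ≤ M) (hτ : Monotone τ)
    (hlow : ∀ N a, D N (a + 2) + V N a ≤ τ N) (hupp : ∀ N a, τ N ≤ D N (a + 3) + V N a)
    (htop : M = ∞ → ∀ N a, V N a = ∞) :
    Monotone (fun N => dyadicMean N (D N)) ∧ Monotone (fun N => dyadicMean N (V N)) ∧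
      (⨆ N, dyadicMean N (D N)) + (⨆ N, dyadicMean N (V N)) = ⨆ N, τ N := by
  have hmD : Monotone (fun N => dyadicMean N (D N)) :=
    monotone_dyadicMean (fun N a => (hD N a).ge)
      fun N a => (hD N a).ge.trans (hDmono _ (Nat.le_succ _))
  by_cases hM : M = ∞
  · have hV := htop hM
    refine ⟨hmD, ?_, ?_⟩
    · exact monotone_dyadicMean (fun N a => by rw [hV, hV]) (fun N a => by rw [hV, hV])
    · have h1 : ⨆ N, dyadicMean N (V N) = ∞ :=
        top_le_iff.1 ((dyadicMean_eq_top 0 (hV 0)).ge.trans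
          (le_iSup (fun N => dyadicMean N (V N)) 0))
      have h2 : ⨆ N, τ N = ∞ := by
        refine top_le_iff.1 (le_trans ?_ (le_iSup τ 0))
        have := hlow 0 0
        rwa [hV, add_top] at this
      rw [h1, h2, add_top]
  -- The offsets 2 and 3 in `hlow` and `hupp` serve here: both children `k = 2 * a` and `k = 2 * a +
  -- 1` satisfy `k + 3 ≤ 2 * (a + 2)`, so the finite term `D N (a + 2)` can be cancelled.
  · have hstep : ∀ N a k, k + 3 ≤ 2 * (a + 2) → V N a ≤ V (N + 1) k := by
      intro N a k hk
      have hfin : D N (a + 2) ≠ ∞ := ((hDM N _).trans_lt (lt_top_iff_ne_top.2 hM)).ne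
      refine (ENNReal.add_le_add_iff_left hfin).1 ?_
      refine (hlow N a).trans ((hτ N.le_succ).trans ((hupp (N + 1) k).trans ?_))
      gcongr
      rw [← hD N (a + 2)]
      exact hDmono _ hk
    have hmV : Monotone (fun N => dyadicMean N (V N)) :=
      monotone_dyadicMean (fun N a => hstep N a _ (by omega)) fun N a => hstep N a _ (by omega)
    refine ⟨hmD, hmV, le_antisymm ?_ ?_⟩
    · rw [ENNReal.iSup_add_iSup_of_monotone hmD hmV]
      refine iSup_mono fun N => ?_
      rw [dyadicMean_add]
      refine (dyadicMean_mono N fun a => ?_).trans (dyadicMean_const N (τ N)).le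
      refine le_trans ?_ (hlow N a)
      gcongr
      exact hDmono N (by omega)
    · set H := ⨆ N, dyadicMean N (D N)
      set W := ⨆ N, dyadicMean N (V N)
      have hbd : ∀ N, τ N ≤ H + W + (3 * M) / (2 ^ N : ℕ) := by
        intro N
        calc τ N = dyadicMean N (fun _ => τ N) := (dyadicMean_const N _).symm
          _ ≤ dyadicMean N (fun a => D N (a + 3)) + dyadicMean N (V N) := by
            rw [dyadicMean_add]
            exact dyadicMean_mono N fun a => hupp N a
          _ ≤ (dyadicMean N (D N) + (3 * M) / (2 ^ N : ℕ)) + dyadicMean N (V N) := by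
            gcongr
            rw [dyadicMean, dyadicMean, ← ENNReal.add_div]
            exact ENNReal.div_le_div_right (by exact_mod_cast sum_range_shift_le (hDM N) _ 3) _
          _ = dyadicMean N (D N) + dyadicMean N (V N) + (3 * M) / (2 ^ N : ℕ) := by ring
          _ ≤ _ := by
            gcongr
            · exact le_iSup (fun N => dyadicMean N (D N)) N
            · exact le_iSup (fun N => dyadicMean N (V N)) N
      refine iSup_le fun K => ?_
      have hlim : Tendsto (fun N : ℕ => H + W + (3 * M) * ((2 ^ N : ℕ) : ℝ≥0∞)⁻¹) atTop
          (𝓝 (H + W + (3 * M) * 0)) := by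
        refine tendsto_const_nhds.add (ENNReal.Tendsto.const_mul ?_ (Or.inr ?_))
        · exact ENNReal.tendsto_inv_nat_nhds_zero.comp
            (tendsto_pow_atTop_atTop_of_one_lt one_lt_two)
        · exact ENNReal.mul_ne_top (by simp) hM
      rw [mul_zero, add_zero] at hlim
      refine ge_of_tendsto hlim ?_
      filter_upwards [eventually_ge_atTop K] with N hN
      exact (hτ hN).trans (hbd N)

end DyadicMean

/-! ### Dyadic paths in `S` and approximate complements. -/

section Realification

open CuFunctional

variable {S : Type*} [AddCommMonoid S] [PartialOrder S]

theorem mem_realification_dyadicMean {φ : ℕ → ℕ → CuFunctional S → ℝ≥0∞}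
    (hφ : ∀ N a, IsHatQuotient (φ N a))
    (hm : ∀ l, Monotone fun N => dyadicMean N fun a => φ N a l) :
    (fun l => ⨆ N, dyadicMean N fun a => φ N a l) ∈ realification S := by
  refine mem_realification_iff.2
    ⟨fun N l => dyadicMean N fun a => φ N a l, fun N => ?_, fun i j hij l => hm l hij, ?_⟩
  · have := (IsHatQuotient.sum (hφ N) (Finset.range (2 ^ N))).div (k := 2 ^ N) (by positivity)
    convert this using 2 with l
    simp only [dyadicMean, Finset.sum_apply]
  · exact funext fun l => by rw [iSup_apply]

variable [IsOrderedAddMonoid S]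

/-- A rapidly increasing sequence can be refined at all dyadic points. -/
theorem IsCuAlmostAlgebraic.exists_dyadic_refinement (hS : IsCuAlmostAlgebraic S) {u : ℕ → S}
    (hu : ∀ n, SeqWayBelow (u n) (u (n + 1))) :
    ∃ C : ℕ → ℕ → S, C 0 = u ∧ (∀ N i, C (N + 1) (2 * i) = C N i) ∧
      ∀ N i, SeqWayBelow (C N i) (C N (i + 1)) := by
  choose! z hz1 hz2 using fun x y : S => hS.exists_between (x := x) (z := y)
  let C : ℕ → ℕ → S := fun N => Nat.rec u
    (fun _ c i => if i % 2 = 0 then c (i / 2) else z (c (i / 2)) (c (i / 2 + 1))) N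
  have h0 : ∀ N i, C (N + 1) (2 * i) = C N i := by
    intro N i
    change (if 2 * i % 2 = 0 then C N (2 * i / 2) else _) = _
    rw [if_pos (by omega), Nat.mul_div_cancel_left _ two_pos]
  have h1 : ∀ N i, C (N + 1) (2 * i + 1) = z (C N i) (C N (i + 1)) := by
    intro N i
    change (if (2 * i + 1) % 2 = 0 then _ else z (C N ((2 * i + 1) / 2)) (C N ((2 * i + 1) / 2 + 1)))
      = _
    rw [if_neg (by omega), show (2 * i + 1) / 2 = i by omega]
  refine ⟨C, rfl, h0, fun N => ?_⟩
  induction N with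
  | zero => exact hu
  | succ N ih =>
    intro i
    obtain ⟨j, rfl | rfl⟩ := Nat.even_or_odd' i
    · rw [h0, h1]
      exact hz1 _ _ (ih j)
    · rw [h1, show 2 * j + 1 + 1 = 2 * (j + 1) by ring, h0]
      exact hz2 _ _ (ih j)

/-- Approximate complements in the realification: if `y ≪ z ≪ s` and `ŝ / n ≤ t̂ / m`, then for
`B < A` the functions `B ŷ / (A n)` and `B ẑ / (A n)` have a common approximate complement
in `t̂ / m`, which is infinite wherever `ŝ` is. -/
theorem IsCuAlmostAlgebraic.exists_complement (hS : IsCuAlmostAlgebraic S) {y z s t : S}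
    {n m A B : ℕ} (hyz : SeqWayBelow y z) (hzs : SeqWayBelow z s) (hn : 0 < n) (hm : 0 < m)
    (hBA : B < A)
    (hst : (fun l : CuFunctional S => hat s l / (n : ℝ≥0∞)) ≤ fun l => hat t l / (m : ℝ≥0∞)) :
    ∃ v : CuFunctional S → ℝ≥0∞, IsHatQuotient v ∧
      (∀ l, hat (B • y) l / (A * n : ℕ) + v l ≤ hat t l / m) ∧
      (∀ l, hat t l / m ≤ hat (B • z) l / (A * n : ℕ) + v l) ∧
      ∀ l, hat s l = ∞ → v l = ∞ := by
  have hn0 : (n : ℝ≥0∞) ≠ 0 := by exact_mod_cast hn.ne'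
  have hm0 : (m : ℝ≥0∞) ≠ 0 := by exact_mod_cast hm.ne'
  have hle : ∀ l : CuFunctional S, hat (m • s) l ≤ hat (n • t) l := by
    intro l
    have h := hst l
    dsimp only at h
    rw [ENNReal.div_le_iff_le_mul (Or.inl hn0) (Or.inl (by simp))] at h
    rw [hat_nsmul, hat_nsmul]
    calc (m : ℝ≥0∞) * hat s l ≤ m * (hat t l / m * n) := by gcongr
      _ = n * (m * (hat t l / m)) := by ring
      _ = n * hat t l := by rw [ENNReal.mul_div_cancel hm0 (by simp)]
  obtain ⟨p, q, hqp, hpq⟩ := hS.exists_nsmul_le (hS.nsmul_wayBelow hzs m) hle hBA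
  have hp : 0 < p := Nat.pos_of_ne_zero (by rintro rfl; omega)
  have hA : 0 < A := by omega
  obtain ⟨r, hr1, hr2⟩ := hS.O5 _ _ _
    (hS.nsmul_wayBelow (hS.nsmul_wayBelow hyz m) p) hpq
  obtain ⟨e, he⟩ := Nat.exists_eq_add_of_lt hqp
  -- O5 gives `p • m • y + r ≤ q • n • t ≤ p • m • z + r`. After multiplication by `B`, adding `(e +
  -- 1) • n • t` completes the middle to `(A * p) • n • t`, since `A * p = B * q + e + 1`. As `e + 1
  -- > 0`, `x̂` is infinite wherever `t̂` is.
  set x : S := B • r + (e + 1) • n • t with hx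
  have key : ∀ l : CuFunctional S, ∀ w : S,
      hat (B • w) l / (A * n : ℕ) + hat x l / ((p * m) * (A * n) : ℕ) =
        hat (B • (p • m • w + r) + (e + 1) • n • t) l / ((p * m) * (A * n) : ℕ) := by
    intro l w
    have hpm : ((p * m : ℕ) : ℝ≥0∞) ≠ 0 := by exact_mod_cast (Nat.mul_pos hp hm).ne'
    rw [Nat.cast_mul (p * m), ← ENNReal.mul_div_mul_left (hat (B • w) l) _ hpm (ENNReal.natCast_ne_top _),
      ← ENNReal.add_div, hx]
    congr 1
    simp only [hat_add, hat_nsmul]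
    push_cast
    ring
  have key' : ∀ l : CuFunctional S,
      hat (B • q • n • t + (e + 1) • n • t) l / ((p * m) * (A * n) : ℕ) = hat t l / m := by
    intro l
    have hc : ((A * p * n : ℕ) : ℝ≥0∞) ≠ 0 := by
      exact_mod_cast (Nat.mul_pos (Nat.mul_pos hA hp) hn).ne'
    have h1 : hat (B • q • n • t + (e + 1) • n • t) l = ((A * p * n : ℕ) : ℝ≥0∞) * hat t l := by
      rw [he]
      simp only [hat_add, hat_nsmul]
      push_cast
      ring
    rw [h1, show p * m * (A * n) = (A * p * n) * m by ring, Nat.cast_mul (A * p * n),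
      ENNReal.mul_div_mul_left _ _ hc (ENNReal.natCast_ne_top _)]
  refine ⟨fun l => hat x l / ((p * m) * (A * n) : ℕ),
    ⟨x, _, Nat.mul_pos (Nat.mul_pos hp hm) (Nat.mul_pos hA hn), rfl⟩, fun l => ?_, fun l => ?_,
    fun l hl => ?_⟩
  · rw [key, ← key']
    exact ENNReal.div_le_div_right (hat_mono l (by gcongr)) _
  · dsimp only
    rw [key, ← key']
    exact ENNReal.div_le_div_right (hat_mono l (by gcongr)) _
  · have hnt : (n : ℝ≥0∞) * hat t l = ∞ := by
      have := hle l
      rw [hat_nsmul, hat_nsmul, hl, ENNReal.mul_top hm0] at this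
      exact top_le_iff.1 this
    have hxt : hat x l = ∞ := by
      rw [hx, hat_add, hat_nsmul l (e + 1), hat_nsmul l n, hnt, ENNReal.mul_top (by simp), add_top]
    dsimp only
    rw [hxt]
    exact ENNReal.top_div_of_ne_top (ENNReal.natCast_ne_top _)

end Realification

/-! ### Assembly of `h` and `h'`. -/

theorem proposition3p9 {S : Type*} [AddCommMonoid S] [PartialOrder S] [IsOrderedAddMonoid S]
    (hS : IsCuAlmostAlgebraic S) (f' f g : realification S)
    (hf : SeqWayBelow f' f) (hfg : f ≤ g) :
    ∃ h h' : realification S, SeqWayBelow f' h ∧ SeqWayBelow h f ∧ h + h' = g := by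
  obtain ⟨u, s, n, A, B, hu, hus, hn, hBA, hlow, hupp⟩ :=
    hS.exists_hat_between f.2 (hS.seqWayBelow_realification_iff.1 hf)
  obtain ⟨t, m, hm, htm, hg⟩ := g.2
  set τ : ℕ → CuFunctional S → ℝ≥0∞ := fun i l => CuFunctional.hat (t i) l / (m i : ℝ≥0∞) with hτ
  have hgτ : (g : CuFunctional S → ℝ≥0∞) = ⨆ i, τ i :=
    funext fun l => by rw [hg, iSup_apply]
  obtain ⟨j, hj⟩ := hupp τ (fun i => IsHatQuotient.mem ⟨t i, m i, hm i, rfl⟩) htm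
    ((show (f : CuFunctional S → ℝ≥0∞) ≤ g from hfg).trans hgτ.le)
  obtain ⟨C, hC0, hC, hCw⟩ := hS.exists_dyadic_refinement hu
  have hCpow : ∀ N i, C N (2 ^ N * i) = u i := by
    intro N i
    induction N with
    | zero => simp [hC0]
    | succ N ih => rw [pow_succ', mul_assoc, hC, ih]
  have hCs : ∀ N i, SeqWayBelow (C N i) s := fun N i =>
    SeqWayBelow.of_le
      ((SeqWayBelow.monotone (hCw N) (Nat.le_mul_of_pos_left i (by positivity))).trans
        (hCpow N i).le) (hus i)
  -- The complement at level `N` is taken in `τ (j + N)`, so that the two suprema add up to `g` and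
  -- not merely to `τ j`. The path continues beyond time 1, so the indices `a + 2` and `a + 3` need
  -- no boundary case.
  choose V hVq hVlow hVupp hVtop using fun N a =>
    hS.exists_complement (hCw N (a + 2)) (hCs N (a + 2 + 1)) hn (hm (j + N)) hBA
      (hj.trans (htm (Nat.le_add_right j N)))
  set D : ℕ → ℕ → CuFunctional S → ℝ≥0∞ := fun N a l =>
    CuFunctional.hat (B • C N a) l / (A * n : ℕ) with hD
  have hDs : ∀ (x : S) (l : CuFunctional S), SeqWayBelow x s →
      CuFunctional.hat (B • x) l / (A * n : ℕ) ≤ CuFunctional.hat s l / n := by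
    intro x l hx
    have hA0 : (A : ℝ≥0∞) ≠ 0 := by exact_mod_cast (by omega : A ≠ 0)
    rw [Nat.cast_mul, ← ENNReal.mul_div_mul_left (CuFunctional.hat s l) _ hA0 (by simp),
      CuFunctional.hat_nsmul]
    refine ENNReal.div_le_div_right (mul_le_mul' ?_ (CuFunctional.hat_mono l hx.le)) _
    exact_mod_cast hBA.le
  have hn0 : (n : ℝ≥0∞) ≠ 0 := by exact_mod_cast hn.ne'
  have key := fun l => iSup_dyadicMean_add (D := fun N a => D N a l) (V := fun N a => V N a l)
    (τ := fun N => τ (j + N) l) (M := CuFunctional.hat s l / n)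
    (fun N a b hab => ENNReal.div_le_div_right (CuFunctional.hat_mono l
      (nsmul_le_nsmul_right (SeqWayBelow.monotone (hCw N) hab) B)) _)
    (fun N a => by simp only [hD, hC])
    (fun N a => hDs _ l (hCs N a))
    (fun a b hab => htm (Nat.add_le_add_left hab j) l)
    (fun N a => hVlow N a l) (fun N a => hVupp N a l)
    (fun htop N a => hVtop N a l (by
      by_contra hne
      exact ENNReal.div_ne_top hne hn0 htop))
  have hDq : ∀ N a, IsHatQuotient (D N a) := fun N a =>
    ⟨_, _, Nat.mul_pos (by omega) hn, rfl⟩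
  refine ⟨⟨_, mem_realification_dyadicMean hDq fun l => (key l).1⟩,
    ⟨_, mem_realification_dyadicMean hVq fun l => (key l).2.1⟩,
    hS.seqWayBelow_realification_iff.2 (hlow.trans_le fun l => ?_),
    hS.seqWayBelow_realification_iff.2 (PointwiseWayBelow.of_le (fun l => ?_) hupp),
    Subtype.ext (funext fun l => ?_)⟩
  -- The Riemann sum at level 0 is the single term `B û_0 / (A n)`, which already lies above `f'`.
  · refine le_iSup_of_le 0 ?_
    simp [dyadicMean, hD, hC0]
  · exact iSup_le fun N => (dyadicMean_mono N fun a => hDs _ l (hCs N a)).trans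
      (dyadicMean_const N _).le
  · refine (key l).2.2.trans ?_
    rw [hgτ, iSup_apply]
    refine le_antisymm (iSup_le fun N => le_iSup (fun i => τ i l) (j + N)) ?_
    exact iSup_le fun i => le_iSup_of_le i (htm (Nat.le_add_left i j) l)
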